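/- For a sequence $f=(f_i(q))_{i\ge 0}$ of polynomials with real coefficients let $\mathcal L f=(g_i(q))_{i\ge 1}$ with $g_i(q)=f_{i-1}(q)f_{i+1}(q)-f_i(q)^2$, and let $\mathcal L^m$ be its $m$-fold iterate (so the sequence $\mathcal L^m f$ is indexed by $i\ge m$). The sequence $f$ is called $k$-$q$-log-convex if for every $0\le m\le k$ all polynomials of the sequence $\mathcal L^m f$ have only nonnegative coefficients. Each of the following six sequences, indexed by $n\ge 0$, is $3$-$q$-log-convex: (i) the Bell polynomials $B_n(q)=\sum_{k=0}^n S(n,k)q^k$, where $S(n,k)$ are the Stirling numbers of the second kind; (ii) the Eulerian polynomials $E_n(q)=\sum_{k=0}^n A(n,k)q^k$, where for $n\ge1$ the Eulerian number $A(n,k)$ is the number of permutations $a_1a_2\cdots a_n$ of $\{1,\dots,n\}$ having exactly $k-1$ descents (indices $1\le i\le n-1$ with $a_i>a_{i+1}$), and $E_0(q)=1$; (iii) the $q$-Schröder numbers $r_n(q)=\sum_{k=0}^n\binom{n+k}{n-k}\frac{1}{k+1}\binom{2k}{k}q^k$; (iv) the $q$-central Delannoy numbers $D_n(q)=\sum_{k=0}^n\binom{n+k}{n-k}\binom{2k}{k}q^k$;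 (v) the Narayana polynomials of type $A$, $N_n(q)=\sum_{k=1}^n\frac1n\binom nk\binom n{k-1}q^k$ for $n\ge1$, and $N_0(q)=1$; (vi) the Narayana polynomials of type $B$, $W_n(q)=\sum_{k=0}^n\binom nk^2q^k$. -/

import Mathlib

open Polynomial

namespace QLogConvex

/-- A real polynomial is `q`-nonnegative (`f ≥_q 0`) if all its coefficients are nonnegative. -/
def CoeffNonneg (f : ℝ[X]) : Prop :=
  ∀ j : ℕ, 0 ≤ f.coeff j

/-- The operator `𝓛`, which sends `(f_i)_{i ≥ 0}` to `(g_i)_{i ≥ 1}` with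
`g_i = f_{i-1} f_{i+1} - f_i ^ 2`. The image is re-indexed to start at `0`: the entry with index
`i` is `g_{i+1}`, so that `𝓛` can be iterated without any boundary convention. -/
noncomputable def opL (f : ℕ → ℝ[X]) : ℕ → ℝ[X] :=
  fun i => f i * f (i + 2) - f (i + 1) ^ 2

/-- A sequence is `k`-`q`-log-convex if, for every `m ≤ k`, all members of its image under the
`m`-fold iterate of `𝓛` have nonnegative coefficients (`m = 0` included). -/
def IsQLogConvex (k : ℕ) (f : ℕ → ℝ[X]) : Prop :=
  ∀ m ≤ k, ∀ i : ℕ, CoeffNonneg (opL^[m] f i)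

/-- The Bell polynomials `B_n(q) = ∑_{k=0}^n S(n,k) q^k`. -/
noncomputable def bellPoly (n : ℕ) : ℝ[X] :=
  ∑ k ∈ Finset.range (n + 1), C (Nat.stirlingSecond n k : ℝ) * X ^ k

/-- The number of descents of a permutation `π = a_1 a_2 ⋯ a_n` (here `n = m + 1`), that is, of
`i ∈ {1, …, n - 1}` with `a_i > a_{i+1}`. -/
def descents {m : ℕ} (π : Equiv.Perm (Fin (m + 1))) : ℕ :=
  (Finset.univ.filter fun i : Fin m => π i.succ < π i.castSucc).card

/-- The Eulerian number `A(n,k)`: the number of permutations of `n` letters having `k - 1`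
descents (for `n ≥ 1`; in particular `A(n,0) = 0`), with the usual convention that `A(0,0) = 1`
and `A(0,k) = 0` for `k ≥ 1`. -/
def eulerianNumber : ℕ → ℕ → ℕ
  | 0, k => if k = 0 then 1 else 0
  | m + 1, k =>
    (Finset.univ.filter fun π : Equiv.Perm (Fin (m + 1)) => descents π + 1 = k).card

/-- The Eulerian polynomials `E_n(q) = ∑_{k=0}^n A(n,k) q^k`. -/
noncomputable def eulerianPoly (n : ℕ) : ℝ[X] :=
  ∑ k ∈ Finset.range (n + 1), C (eulerianNumber n k : ℝ) * X ^ k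

/-- The `q`-Schröder numbers
`r_n(q) = ∑_{k=0}^n binom(n+k, n-k) * (1/(k+1)) * binom(2k, k) * q^k`. -/
noncomputable def schroderPoly (n : ℕ) : ℝ[X] :=
  ∑ k ∈ Finset.range (n + 1),
    C (((n + k).choose (n - k) : ℝ) * (1 / ((k : ℝ) + 1)) * ((2 * k).choose k : ℝ)) * X ^ k

/-- The `q`-central Delannoy numbers `D_n(q) = ∑_{k=0}^n binom(n+k, n-k) * binom(2k, k) * q^k`. -/
noncomputable def delannoyPoly (n : ℕ) : ℝ[X] :=
  ∑ k ∈ Finset.range (n + 1),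
    C (((n + k).choose (n - k) : ℝ) * ((2 * k).choose k : ℝ)) * X ^ k

/-- The Narayana polynomials (of type `A`)
`N_n(q) = ∑_{k=1}^n (1/n) * binom(n, k) * binom(n, k-1) * q^k` for `n ≥ 1`, and `N_0(q) = 1`. -/
noncomputable def narayanaPolyA (n : ℕ) : ℝ[X] :=
  if n = 0 then 1
  else ∑ k ∈ Finset.Icc 1 n,
    C ((1 / (n : ℝ)) * (n.choose k : ℝ) * (n.choose (k - 1) : ℝ)) * X ^ k

/-- The Narayana polynomials of type `B`, `W_n(q) = ∑_{k=0}^n binom(n, k)^2 * q^k`. -/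
noncomputable def narayanaPolyB (n : ℕ) : ℝ[X] :=
  ∑ k ∈ Finset.range (n + 1), C ((n.choose k : ℝ) ^ 2) * X ^ k

end QLogConvex

namespace QLogConvex

/-! The iterates of `opL` are controlled by contiguous Hankel minors `H_r(i) = det (f (i + a + b))`
of size `r`: `𝓛 f` is `H_2`, `𝓛² f` is `f (i + 2) * H_3(i)`, and the Desnanot–Jacobi identity turns
`𝓛³ f` into `H_2(i + 2) * (f (i + 2) * f (i + 4) * H_4(i) + H_3(i + 1) ^ 2)`. So it suffices that
all these minors have nonnegative coefficients (`isQLogConvex_three_of_hankel`).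

Each of the six sequences is the first column of a triangular array whose rows are obtained by
repeated multiplication by a tridiagonal matrix `T`, so `f n = (T ^ n) 0 0`. If `T` is totally
positive over `nonnegCoeff`, Cauchy–Binet applied to `T ^ (i + a) * T ^ b` gives the Hankel minors
(`hankel_det_mem_nonnegCoeff`). Total positivity of `T` reduces to its contiguous principal minors,
the continuants (`det_tridiag_mem_nonnegCoeff`), and these are handled by a splitting `g = x + y`,
`u * s = x * y⁺` with `y⁺` the shift of `y` (`continuant_mem_nonnegCoeff`), or by a closed form.

The arrays are: iterated derivatives (Bell), coefficients of a two-variable Eulerian polynomial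
(Eulerian), and coefficients of powers of `(Y + a) (Y + c)`, with `(a, c) = (X, 1)` for Narayana and
`(1 + X, X)` for Schröder and Delannoy. -/

/-- The semiring of real polynomials with nonnegative coefficients. -/
def nonnegCoeff : Subsemiring ℝ[X] where
  carrier := {f | CoeffNonneg f}
  zero_mem' j := by simp
  one_mem' j := by rw [coeff_one]; split_ifs <;> norm_num
  add_mem' hf hg j := by rw [coeff_add]; exact add_nonneg (hf j) (hg j)
  mul_mem' hf hg j := by
    rw [coeff_mul]; exact Finset.sum_nonneg fun x _ => mul_nonneg (hf _) (hg _)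

theorem mem_nonnegCoeff {f : ℝ[X]} : f ∈ nonnegCoeff ↔ CoeffNonneg f := Iff.rfl

theorem X_mem_nonnegCoeff : (X : ℝ[X]) ∈ nonnegCoeff := fun j => by
  rw [coeff_X]; split_ifs <;> norm_num

/-- Removes the factor `r!` that appears when Cauchy–Binet is summed over all maps. -/
theorem mem_nonnegCoeff_of_natCast_mul {n : ℕ} (hn : n ≠ 0) {f : ℝ[X]}
    (h : (n : ℝ[X]) * f ∈ nonnegCoeff) : f ∈ nonnegCoeff := fun j => by
  have := h j
  rw [← C_eq_natCast, coeff_C_mul] at this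
  exact nonneg_of_mul_nonneg_right this (by positivity)

/-! ### Cauchy–Binet and nonnegativity of determinants of products. -/

section CauchyBinet

variable {R : Type*} [CommRing R] {ι κ : Type*} [Fintype ι] [DecidableEq ι] [Fintype κ]

theorem det_mul_eq_sum_prod_mul_det (A : Matrix ι κ R) (B : Matrix κ ι R) :
    (A * B).det = ∑ f : ι → κ, (∏ i, A i (f i)) * (B.submatrix f id).det := by
  classical
  have h : A * B = fun i => ∑ k, A i k • B k := by
    ext i j; simp [Matrix.mul_apply, Finset.sum_apply]
  rw [h]
  change (Matrix.detRowAlternating : (ι → R) [⋀^ι]→ₗ[R] R).toMultilinearMap _ = _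
  rw [MultilinearMap.map_sum]
  refine Finset.sum_congr rfl fun f _ => ?_
  rw [MultilinearMap.map_smul_univ]
  rfl

/-- The Cauchy–Binet formula, with the sum over all maps instead of over all subsets. -/
theorem factorial_mul_det_mul (A : Matrix ι κ R) (B : Matrix κ ι R) :
    ((Fintype.card ι).factorial : R) * (A * B).det =
      ∑ f : ι → κ, (A.submatrix id f).det * (B.submatrix f id).det := by
  -- Permuting the rows gives one expansion of the same determinant for each `σ`; adding them all
  -- assembles the minors of `A`.
  have h : ∀ σ : Equiv.Perm ι, (A * B).det = ∑ f : ι → κ,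
      ((Equiv.Perm.sign σ : ℤ) : R) * (∏ i, A (σ i) (f i)) * (B.submatrix f id).det := by
    intro σ
    rw [det_mul_eq_sum_prod_mul_det, ← (Equiv.arrowCongr σ (Equiv.refl κ)).sum_comp]
    refine Finset.sum_congr rfl fun f _ => ?_
    have h1 : ∏ i, A i (f (σ.symm i)) = ∏ i, A (σ i) (f i) := by
      rw [← Equiv.prod_comp σ]; simp
    have h2 : (B.submatrix (f ∘ σ.symm) id).det
        = ((Equiv.Perm.sign σ : ℤ) : R) * (B.submatrix f id).det := by
      rw [← Equiv.Perm.sign_symm, ← Matrix.det_permute]; rfl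
    change (∏ i, A i (f (σ.symm i))) * (B.submatrix (f ∘ σ.symm) id).det = _
    rw [h1, h2]; ring
  calc ((Fintype.card ι).factorial : R) * (A * B).det
      = ∑ _σ : Equiv.Perm ι, (A * B).det := by simp [Fintype.card_perm]
    _ = _ := by
      rw [Finset.sum_congr rfl fun σ _ => h σ, Finset.sum_comm]
      refine Finset.sum_congr rfl fun f _ => ?_
      rw [← Finset.sum_mul, Matrix.det_apply' (A.submatrix id f)]; rfl

end CauchyBinet

/-- If all maximal minors of `A` and `B` are nonnegative, then so is `det (A * B)`. -/
theorem det_mul_mem_nonnegCoeff {r N : ℕ} (A : Matrix (Fin r) (Fin N) ℝ[X])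
    (B : Matrix (Fin N) (Fin r) ℝ[X])
    (hA : ∀ s : Fin r → Fin N, StrictMono s → (A.submatrix id s).det ∈ nonnegCoeff)
    (hB : ∀ s : Fin r → Fin N, StrictMono s → (B.submatrix s id).det ∈ nonnegCoeff) :
    (A * B).det ∈ nonnegCoeff := by
  refine mem_nonnegCoeff_of_natCast_mul (Nat.factorial_ne_zero (Fintype.card (Fin r))) ?_
  rw [factorial_mul_det_mul]
  refine sum_mem fun f _ => ?_
  -- Sorting an injective `f` multiplies both minors by the same sign, so their product is that of
  -- an increasing map; a non-injective `f` repeats a row of `B`.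
  by_cases hf : Function.Injective f
  · set σ := Tuple.sort f
    have hs : StrictMono (f ∘ σ) :=
      (Tuple.monotone_sort f).strictMono_of_injective (hf.comp σ.injective)
    have h1 : (A.submatrix id (f ∘ σ)).det
        = ((Equiv.Perm.sign σ : ℤ) : ℝ[X]) * (A.submatrix id f).det := by
      rw [← Matrix.det_permute']; rfl
    have h2 : (B.submatrix (f ∘ σ) id).det
        = ((Equiv.Perm.sign σ : ℤ) : ℝ[X]) * (B.submatrix f id).det := by
      rw [← Matrix.det_permute]; rfl
    have h3 : ((Equiv.Perm.sign σ : ℤ) : ℝ[X]) * ((Equiv.Perm.sign σ : ℤ) : ℝ[X]) = 1 := by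
      rw [← Int.cast_mul, ← Units.val_mul, Int.units_mul_self]; simp
    have h4 := mul_mem (hA _ hs) (hB _ hs)
    rw [h1, h2, mul_mul_mul_comm, h3, one_mul] at h4
    exact h4
  · obtain ⟨i, j, hij, hne⟩ : ∃ i j, f i = f j ∧ i ≠ j := by
      simpa [Function.Injective] using hf
    rw [Matrix.det_zero_of_row_eq (M := B.submatrix f id) hne (by ext k; simp [hij]), mul_zero]
    exact zero_mem _

/-! ### Minors of tridiagonal matrices. -/

section Tridiagonal

variable {R : Type*} [CommRing R]

/-- The tridiagonal matrix with superdiagonal `u`, diagonal `g` and subdiagonal `s`. -/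
def tridiag (u g s : ℕ → R) (i j : ℕ) : R :=
  if j = i + 1 then u i else if j = i then g i else if i = j + 1 then s j else 0

theorem tridiag_self (u g s : ℕ → R) (i : ℕ) : tridiag u g s i i = g i := by
  simp [tridiag]

theorem tridiag_succ_right (u g s : ℕ → R) (i : ℕ) : tridiag u g s i (i + 1) = u i := by
  simp [tridiag]

theorem tridiag_succ_left (u g s : ℕ → R) (i : ℕ) : tridiag u g s (i + 1) i = s i := by
  simp [tridiag, add_assoc]

/-- The principal minor of size `m` of a tridiagonal matrix that starts at the index `p`. -/
def continuant (u g s : ℕ → R) (p : ℕ) : ℕ → R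
  | 0 => 1
  | 1 => g p
  | m + 2 => g (p + m + 1) * continuant u g s p (m + 1)
      - u (p + m) * s (p + m) * continuant u g s p m

theorem det_succ_of_last_row (M : ℕ → ℕ → R) (t s : ℕ → ℕ) (r : ℕ)
    (h : ∀ j < r, M (t r) (s j) = 0) :
    (Matrix.of fun i j : Fin (r + 1) => M (t i) (s j)).det =
      M (t r) (s r) * (Matrix.of fun i j : Fin r => M (t i) (s j)).det := by
  rw [Matrix.det_succ_row _ (Fin.last r), Fin.sum_univ_castSucc, Finset.sum_eq_zero, zero_add]
  · have h1 : (-1 : R) ^ (r + r) = 1 := Even.neg_one_pow ⟨r, rfl⟩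
    simp only [Fin.val_last, h1, Matrix.of_apply, one_mul]
    congr 2
    ext i j
    simp [Fin.succAbove_last]
  · intro j _
    simp [h j j.2]

theorem det_succ_of_last_col (M : ℕ → ℕ → R) (t s : ℕ → ℕ) (r : ℕ)
    (h : ∀ i < r, M (t i) (s r) = 0) :
    (Matrix.of fun i j : Fin (r + 1) => M (t i) (s j)).det =
      M (t r) (s r) * (Matrix.of fun i j : Fin r => M (t i) (s j)).det := by
  have := det_succ_of_last_row (fun i j => M j i) s t r h
  rw [← Matrix.det_transpose, ← Matrix.det_transpose (Matrix.of fun i j : Fin r => M (t i) (s j))]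
  exact this

theorem det_add_two (M : ℕ → ℕ → R) (t s : ℕ → ℕ) (r : ℕ)
    (h1 : ∀ j < r, M (t (r + 1)) (s j) = 0) (h2 : ∀ i < r, M (t i) (s (r + 1)) = 0) :
    (Matrix.of fun i j : Fin (r + 2) => M (t i) (s j)).det =
      M (t (r + 1)) (s (r + 1)) * (Matrix.of fun i j : Fin (r + 1) => M (t i) (s j)).det
      - M (t r) (s (r + 1)) * M (t (r + 1)) (s r) *
        (Matrix.of fun i j : Fin r => M (t i) (s j)).det := by
  rw [Matrix.det_succ_row _ (Fin.last (r + 1)), Fin.sum_univ_castSucc, Fin.sum_univ_castSucc,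
    Finset.sum_eq_zero, zero_add]
  · have e1 : (-1 : R) ^ (r + 1 + (r + 1)) = 1 := Even.neg_one_pow ⟨r + 1, rfl⟩
    have e2 : (-1 : R) ^ (r + 1 + r) = -1 := Odd.neg_one_pow ⟨r, by ring⟩
    -- Deleting the last row and column `r` leaves the columns `s 0, …, s (r - 1), s (r + 1)`, and
    -- the last of these has a single possibly nonzero entry.
    have e3 := det_succ_of_last_col M t (fun j => if j = r then s (r + 1) else s j) r (by
      intro i hi; simpa using h2 i hi)
    have e4 : (Matrix.of fun i j : Fin r => M (t i) (if (j : ℕ) = r then s (r + 1) else s j))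
        = Matrix.of fun i j : Fin r => M (t i) (s j) := by
      ext i j; simp [j.2.ne]
    rw [e4] at e3
    have e5 : ((Matrix.of fun i j : Fin (r + 2) => M (t i) (s j)).submatrix
        (Fin.last (r + 1)).succAbove (Fin.last r).castSucc.succAbove) =
        Matrix.of fun i j : Fin (r + 1) => M (t i) (if (j : ℕ) = r then s (r + 1) else s j) := by
      ext i j
      refine Fin.lastCases ?_ (fun j => ?_) j
      · simp [Fin.succAbove_last]
      · rw [Matrix.submatrix_apply, Fin.succAbove_of_castSucc_lt _ j.castSucc (by
          simp [Fin.lt_def])]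
        simp [Fin.succAbove_last, j.2.ne]
    have e6 : ((Matrix.of fun i j : Fin (r + 2) => M (t i) (s j)).submatrix
        (Fin.last (r + 1)).succAbove (Fin.last (r + 1)).succAbove) =
        Matrix.of fun i j : Fin (r + 1) => M (t i) (s j) := by
      ext i j; simp [Fin.succAbove_last]
    rw [e5, e6, e3]
    simp only [Fin.val_last, Fin.val_castSucc, e1, e2, Matrix.of_apply, if_true]
    ring
  · intro j _
    simp [h1 j j.2]

end Tridiagonal

/-- A tridiagonal matrix with nonnegative entries and nonnegative contiguous principal minors is
totally positive. -/
theorem det_tridiag_mem_nonnegCoeff {u g s : ℕ → ℝ[X]} (hu : ∀ k, u k ∈ nonnegCoeff)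
    (hg : ∀ k, g k ∈ nonnegCoeff) (hs : ∀ k, s k ∈ nonnegCoeff)
    (hD : ∀ p m, continuant u g s p m ∈ nonnegCoeff) {t v : ℕ → ℕ} (ht : StrictMono t)
    (hv : StrictMono v) (r : ℕ) :
    (Matrix.of fun i j : Fin r => tridiag u g s (t i) (v j)).det ∈ nonnegCoeff := by
  set d : ℕ → ℝ[X] := fun r => (Matrix.of fun i j : Fin r => tridiag u g s (t i) (v j)).det
    with hd
  have hM : ∀ i j, tridiag u g s i j ∈ nonnegCoeff := by
    intro i j
    unfold tridiag
    split_ifs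
    exacts [hu _, hg _, hs _, zero_mem _]
  -- The three-term expansion has a minus sign, so nonnegativity alone is not inductive. When the
  -- `r`-th chosen entry is diagonal, the invariant records that two successive leading minors are a
  -- common factor `e` times the continuants of the contiguous run `p, …, p + m` ending there.
  have key : ∀ r, d r ∈ nonnegCoeff ∧ (t r = v r → ∃ e ∈ nonnegCoeff, ∃ p m, t r = p + m ∧
      d (r + 1) = e * continuant u g s p (m + 1) ∧ d r = e * continuant u g s p m) := by
    intro r
    induction r with
    | zero =>
      have h0 : d 0 = 1 := Matrix.det_fin_zero
      refine ⟨h0 ▸ one_mem _, fun h => ⟨1, one_mem _, t 0, 0, rfl, ?_, by simp [h0, continuant]⟩⟩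
      have := det_succ_of_last_row (tridiag u g s) t v 0 (by simp)
      simp only [hd, this, ← h]
      simp [tridiag, continuant]
    | succ r ih =>
      have hdr : d (r + 1) ∈ nonnegCoeff := by
        by_cases h : t r = v r
        · obtain ⟨e, he, p, m, -, h1, -⟩ := ih.2 h
          exact h1 ▸ mul_mem he (hD _ _)
        -- Off the diagonal, the last row or the last column has no nonzero entry before the corner.
        · have : d (r + 1) = tridiag u g s (t r) (v r) * d r := by
            rcases lt_or_gt_of_ne h with h | h
            · refine det_succ_of_last_col _ t v r fun i hi => ?_
              have := ht hi
              unfold tridiag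
              grind
            · refine det_succ_of_last_row _ t v r fun i hi => ?_
              have := hv hi
              unfold tridiag
              grind
          exact this ▸ mul_mem (hM _ _) ih.1
      refine ⟨hdr, fun h => ?_⟩
      have ht1 := ht (Nat.lt_succ_self r)
      have hv1 := hv (Nat.lt_succ_self r)
      have hti : ∀ i < r, t i < t r := fun i hi => ht hi
      have hvi : ∀ i < r, v i < v r := fun i hi => hv hi
      -- If both index sequences advance by one, the run is extended. Otherwise the gap clears the
      -- last row or column and a new run of length one starts, with all earlier minors absorbed
      -- into `e`.
      by_cases hc : t r + 1 = t (r + 1) ∧ v r + 1 = v (r + 1)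
      · obtain ⟨e, he, p, m, hp, h1, h2⟩ := ih.2 (by omega)
        refine ⟨e, he, p, m + 1, by omega, ?_, h1⟩
        have h3 : d (r + 2) = _ := det_add_two (tridiag u g s) t v r
          (fun j hj => by have := hvi j hj; unfold tridiag; grind)
          (fun j hj => by have := hti j hj; unfold tridiag; grind)
        change d (r + 2) = tridiag u g s _ _ * d (r + 1) - _ * d r at h3
        have ev : v (r + 1) = p + m + 1 := by omega
        have ev' : v r = p + m := by omega
        have et : t (r + 1) = p + m + 1 := by omega
        rw [h3, h1, h2, ev, ev', et, hp, tridiag_self, tridiag_succ_right, tridiag_succ_left,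
          continuant]
        ring
      · refine ⟨d (r + 1), hdr, t (r + 1), 0, rfl, ?_, by simp [continuant]⟩
        have : d (r + 2) = tridiag u g s (t (r + 1)) (v (r + 1)) * d (r + 1) := by
          by_cases h' : t r + 1 = t (r + 1)
          · refine det_succ_of_last_row _ t v (r + 1) fun j hj => ?_
            have : v j ≤ v r := hv.monotone (Nat.lt_succ_iff.1 hj)
            unfold tridiag
            grind
          · refine det_succ_of_last_col _ t v (r + 1) fun j hj => ?_
            have : t j ≤ t r := ht.monotone (Nat.lt_succ_iff.1 hj)
            unfold tridiag
            grind
        rw [this, ← h, tridiag_self, continuant, mul_comm]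
  exact (key r).1

/-! ### Powers of a truncated tridiagonal matrix. -/

/-- The truncation to indices `0, …, N` of a tridiagonal matrix. -/
noncomputable def tridiagMatrix (u g s : ℕ → ℝ[X]) (N : ℕ) :
    Matrix (Fin (N + 1)) (Fin (N + 1)) ℝ[X] :=
  Matrix.of fun i j => tridiag u g s i j

section TridiagMatrix

variable {u g s : ℕ → ℝ[X]} {N : ℕ}

/-- Entries of the power count weighted paths with steps of size at most one, and `n` such steps
from `0` stop at `n`. -/
theorem tridiagMatrix_pow_zero_left (n : ℕ) (l : Fin (N + 1)) (h : n < l) :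
    (tridiagMatrix u g s N ^ n) 0 l = 0 := by
  induction n generalizing l with
  | zero => rw [pow_zero, Matrix.one_apply_ne]; rintro rfl; simp at h
  | succ n ih =>
    rw [pow_succ, Matrix.mul_apply]
    refine Finset.sum_eq_zero fun k _ => ?_
    rcases lt_or_ge n k with hk | hk
    · rw [ih k hk, zero_mul]
    · have : tridiagMatrix u g s N k l = 0 := by
        simp only [tridiagMatrix, tridiag, Matrix.of_apply]
        grind
      rw [this, mul_zero]

theorem tridiagMatrix_pow_zero_right (n : ℕ) (l : Fin (N + 1)) (h : n < l) :
    (tridiagMatrix u g s N ^ n) l 0 = 0 := by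
  induction n generalizing l with
  | zero => rw [pow_zero, Matrix.one_apply_ne]; rintro rfl; simp at h
  | succ n ih =>
    rw [pow_succ', Matrix.mul_apply]
    refine Finset.sum_eq_zero fun k _ => ?_
    rcases lt_or_ge n k with hk | hk
    · rw [ih k hk, mul_zero]
    · have : tridiagMatrix u g s N l k = 0 := by
        simp only [tridiagMatrix, tridiag, Matrix.of_apply]
        grind
      rw [this, zero_mul]

theorem tridiagMatrix_pow_mem_nonnegCoeff (hu : ∀ k, u k ∈ nonnegCoeff)
    (hg : ∀ k, g k ∈ nonnegCoeff) (hs : ∀ k, s k ∈ nonnegCoeff) (n : ℕ) (i j : Fin (N + 1)) :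
    (tridiagMatrix u g s N ^ n) i j ∈ nonnegCoeff := by
  induction n generalizing i j with
  | zero =>
    rw [pow_zero, Matrix.one_apply]
    split_ifs
    exacts [one_mem _, zero_mem _]
  | succ n ih =>
    rw [pow_succ, Matrix.mul_apply]
    refine sum_mem fun k _ => mul_mem (ih _ _) ?_
    simp only [tridiagMatrix, tridiag, Matrix.of_apply]
    split_ifs
    exacts [hu _, hg _, hs _, zero_mem _]

end TridiagMatrix

/-- Transfers finite minors to `det_tridiag_mem_nonnegCoeff`, whose index maps are defined on all of
`ℕ`. -/
theorem StrictMono.exists_extension_nat {r N : ℕ} {t : Fin r → Fin N} (ht : StrictMono t) :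
    ∃ t' : ℕ → ℕ, StrictMono t' ∧ ∀ i : Fin r, t' i = t i := by
  refine ⟨fun i => if h : i < r then t ⟨i, h⟩ else N + i, fun i j hij => ?_, fun i => by simp⟩
  by_cases hj : j < r
  · have hi : i < r := hij.trans hj
    simpa [hi, hj] using ht (a := ⟨i, hi⟩) (b := ⟨j, hj⟩) hij
  · by_cases hi : i < r
    · have := (t ⟨i, hi⟩).2
      simp only [hi, hj, dite_true, dite_false]
      omega
    · simp only [hi, hj, dite_false]
      omega

theorem StrictMono.val_le_apply_fin {r N : ℕ} {t : Fin r → Fin N} (ht : StrictMono t)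
    (i : Fin r) : (i : ℕ) ≤ t i := by
  obtain ⟨t', h, h'⟩ := StrictMono.exists_extension_nat ht
  exact h' i ▸ h.le_apply

/-! ### Hankel minors from total positivity. -/

section Hankel

variable {u g s : ℕ → ℝ[X]}

theorem det_rows_zero_mem_nonnegCoeff {r N : ℕ}
    (hu : ∀ k, u k ∈ nonnegCoeff) (hg : ∀ k, g k ∈ nonnegCoeff) (hs : ∀ k, s k ∈ nonnegCoeff)
    (t : Fin r → Fin (N + 1)) (ht : StrictMono t) :
    (Matrix.of fun a b : Fin r => (tridiagMatrix u g s N ^ (a : ℕ)) 0 (t b)).det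
      ∈ nonnegCoeff := by
  rw [Matrix.det_of_isLowerTriangular]
  · exact prod_mem fun a _ => tridiagMatrix_pow_mem_nonnegCoeff hu hg hs _ _ _
  · intro a b hab
    exact tridiagMatrix_pow_zero_left _ _
      (lt_of_lt_of_le (Fin.lt_def.1 hab) (StrictMono.val_le_apply_fin ht b))

theorem det_cols_zero_mem_nonnegCoeff {r N : ℕ}
    (hu : ∀ k, u k ∈ nonnegCoeff) (hg : ∀ k, g k ∈ nonnegCoeff) (hs : ∀ k, s k ∈ nonnegCoeff)
    (t : Fin r → Fin (N + 1)) (ht : StrictMono t) :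
    (Matrix.of fun a b : Fin r => (tridiagMatrix u g s N ^ (b : ℕ)) (t a) 0).det
      ∈ nonnegCoeff := by
  rw [Matrix.det_of_isUpperTriangular]
  · exact prod_mem fun a _ => tridiagMatrix_pow_mem_nonnegCoeff hu hg hs _ _ _
  · intro a b hab
    exact tridiagMatrix_pow_zero_right _ _
      (lt_of_lt_of_le (Fin.lt_def.1 hab) (StrictMono.val_le_apply_fin ht a))

/-- Raising the shift `i` by one multiplies the block of rows on the right by the tridiagonal
matrix, so Cauchy–Binet carries the triangular case `i = 0` upwards. -/
theorem det_rows_mem_nonnegCoeff {r N : ℕ}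
    (hu : ∀ k, u k ∈ nonnegCoeff) (hg : ∀ k, g k ∈ nonnegCoeff) (hs : ∀ k, s k ∈ nonnegCoeff)
    (hD : ∀ p m, continuant u g s p m ∈ nonnegCoeff)
    (i : ℕ) (t : Fin r → Fin (N + 1))
    (ht : StrictMono t) :
    (Matrix.of fun a b : Fin r => (tridiagMatrix u g s N ^ (i + a)) 0 (t b)).det
      ∈ nonnegCoeff := by
  induction i generalizing t with
  | zero => simpa using det_rows_zero_mem_nonnegCoeff hu hg hs t ht
  | succ i ih =>
    have h : (Matrix.of fun a b : Fin r => (tridiagMatrix u g s N ^ (i + 1 + a)) 0 (t b)) =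
        (Matrix.of fun (a : Fin r) b => (tridiagMatrix u g s N ^ (i + a)) 0 b) *
          (tridiagMatrix u g s N).submatrix id t := by
      ext1 a b
      rw [Matrix.of_apply, add_right_comm, pow_succ, Matrix.mul_apply, Matrix.mul_apply]
      rfl
    rw [h]
    refine det_mul_mem_nonnegCoeff _ _ ih fun v hv => ?_
    obtain ⟨t', h1, h2⟩ := StrictMono.exists_extension_nat ht
    obtain ⟨v', h3, h4⟩ := StrictMono.exists_extension_nat hv
    have := det_tridiag_mem_nonnegCoeff hu hg hs hD h3 h1 r
    simp only [h2, h4] at this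
    exact this

/-- If `f n` is the `(0,0)` entry of the `n`-th power of a totally positive tridiagonal matrix,
then the contiguous minors of the Hankel matrix of `f` are nonnegative. -/
theorem hankel_det_mem_nonnegCoeff
    (hu : ∀ k, u k ∈ nonnegCoeff) (hg : ∀ k, g k ∈ nonnegCoeff) (hs : ∀ k, s k ∈ nonnegCoeff)
    (hD : ∀ p m, continuant u g s p m ∈ nonnegCoeff)
    {f : ℕ → ℝ[X]}
    (hf : ∀ N n, n ≤ N → (tridiagMatrix u g s N ^ n) 0 0 = f n) (r i : ℕ) :
    (Matrix.of fun a b : Fin r => f (i + a + b)).det ∈ nonnegCoeff := by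
  have h : (Matrix.of fun a b : Fin r => f (i + a + b)) =
      (Matrix.of fun (a : Fin r) b => (tridiagMatrix u g s (i + 2 * r) ^ (i + a)) 0 b) *
        (Matrix.of fun a (b : Fin r) => (tridiagMatrix u g s (i + 2 * r) ^ (b : ℕ)) a 0) := by
    ext1 a b
    rw [Matrix.of_apply, ← hf (i + 2 * r) _ (by omega), pow_add, Matrix.mul_apply,
      Matrix.mul_apply]
    rfl
  rw [h]
  exact det_mul_mem_nonnegCoeff _ _ (det_rows_mem_nonnegCoeff hu hg hs hD i)
    (det_cols_zero_mem_nonnegCoeff hu hg hs)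

end Hankel

/-! ### Triangular arrays generated by tridiagonal matrices. -/

section Recurrence

variable {u g s : ℕ → ℝ[X]} {A : ℕ → ℕ → ℝ[X]}

/-- The triangular array `A` is generated from `1, 0, 0, …` by a tridiagonal matrix. -/
structure IsGeneratedBy (A : ℕ → ℕ → ℝ[X]) (u g s : ℕ → ℝ[X]) : Prop where
  zero_zero : A 0 0 = 1
  zero_succ : ∀ k, A 0 (k + 1) = 0
  succ_zero : ∀ n, A (n + 1) 0 = g 0 * A n 0 + s 0 * A n 1
  succ_succ : ∀ n k, A (n + 1) (k + 1) =
    u k * A n k + g (k + 1) * A n (k + 1) + s (k + 1) * A n (k + 2)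

theorem IsGeneratedBy.eq_zero_of_lt (h : IsGeneratedBy A u g s) {n k : ℕ} (hk : n < k) :
    A n k = 0 := by
  induction n generalizing k with
  | zero => obtain ⟨k, rfl⟩ := Nat.exists_eq_add_of_lt hk; exact h.zero_succ _
  | succ n ih =>
    obtain ⟨k, rfl⟩ : ∃ j, k = j + 1 := ⟨k - 1, by omega⟩
    rw [h.succ_succ, ih (by omega), ih (by omega), ih (by omega)]
    simp

theorem IsGeneratedBy.succ_eq_sum (h : IsGeneratedBy A u g s) {n N : ℕ} (hn : n < N) (l : ℕ) :
    A (n + 1) l = ∑ k ∈ Finset.range (N + 1), A n k * tridiag u g s k l := by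
  -- The range is enlarged to contain every neighbour of `l`; the added terms vanish because row `n`
  -- is zero beyond `n`.
  have h1 : ∑ k ∈ Finset.range (N + 1), A n k * tridiag u g s k l
      = ∑ k ∈ Finset.range (N + 1 + (l + 2)), A n k * tridiag u g s k l := by
    refine Finset.sum_subset (Finset.range_subset_range.2 (by omega)) fun k _ hk => ?_
    rw [h.eq_zero_of_lt (by simp at hk; omega), zero_mul]
  rw [h1]
  cases l with
  | zero =>
    rw [← Finset.sum_subset (s₁ := {0, 1})]
    · rw [Finset.sum_pair (by simp), tridiag_self, tridiag_succ_left, h.succ_zero]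
      ring
    · intro k; simp; omega
    · intro k _ hk
      have : tridiag u g s k 0 = 0 := by simp at hk; unfold tridiag; grind
      rw [this, mul_zero]
  | succ l =>
    rw [← Finset.sum_subset (s₁ := {l, l + 1, l + 2})]
    · rw [Finset.sum_insert (by simp), Finset.sum_pair (by simp), tridiag_self,
        tridiag_succ_left, tridiag_succ_right, h.succ_succ]
      ring
    · intro k; simp; omega
    · intro k _ hk
      have : tridiag u g s k (l + 1) = 0 := by simp at hk; unfold tridiag; grind
      rw [this, mul_zero]

theorem IsGeneratedBy.tridiagMatrix_pow (h : IsGeneratedBy A u g s) {n N : ℕ} (hn : n ≤ N)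
    (l : Fin (N + 1)) : (tridiagMatrix u g s N ^ n) 0 l = A n l := by
  induction n generalizing l with
  | zero =>
    rw [pow_zero, Matrix.one_apply]
    refine Fin.cases ?_ (fun l => ?_) l
    · simp [h.zero_zero]
    · simp [h.zero_succ, (Fin.succ_ne_zero l).symm]
  | succ n ih =>
    rw [pow_succ, Matrix.mul_apply, h.succ_eq_sum (by omega : n < N), Finset.sum_range]
    refine Finset.sum_congr rfl fun k _ => ?_
    rw [ih (by omega)]
    rfl

end Recurrence

/-! ### From Hankel minors to log-convexity. -/

theorem det_hankel_four (f : ℕ → ℝ[X]) (i : ℕ) :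
    (Matrix.of fun a b : Fin 4 => f (i + a + b)).det =
      f i * (f (i + 2) * f (i + 4) * f (i + 6) + 2 * f (i + 3) * f (i + 4) * f (i + 5)
          - f (i + 4) ^ 3 - f (i + 2) * f (i + 5) ^ 2 - f (i + 3) ^ 2 * f (i + 6))
      - f (i + 1) ^ 2 * (f (i + 4) * f (i + 6) - f (i + 5) ^ 2)
      + 2 * f (i + 1) * f (i + 2) * (f (i + 3) * f (i + 6) - f (i + 4) * f (i + 5))
      - 2 * f (i + 1) * f (i + 3) * (f (i + 3) * f (i + 5) - f (i + 4) ^ 2)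
      - f (i + 2) ^ 2 * (f (i + 2) * f (i + 6) - f (i + 4) ^ 2)
      + 2 * f (i + 2) * f (i + 3) * (f (i + 2) * f (i + 5) - f (i + 3) * f (i + 4))
      - f (i + 3) ^ 2 * (f (i + 2) * f (i + 4) - f (i + 3) ^ 2) := by
  have h2 : (Fin.succ (2 : Fin 3)) = 3 := rfl
  rw [Matrix.det_succ_row_zero]
  change ∑ j : Fin 4, _ = _
  simp [Fin.sum_univ_four, Matrix.det_fin_three, Fin.succAbove, h2, add_assoc]
  ring

theorem isQLogConvex_three_of_hankel {f : ℕ → ℝ[X]}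
    (h : ∀ r i, (Matrix.of fun a b : Fin r => f (i + a + b)).det ∈ nonnegCoeff) :
    IsQLogConvex 3 f := by
  have h1 : ∀ i, f i ∈ nonnegCoeff := fun i => by simpa using h 1 i
  have h2 : ∀ i, opL f i ∈ nonnegCoeff := fun i => by
    have := h 2 i
    rw [Matrix.det_fin_two] at this
    simp only [Matrix.of_apply, Fin.val_zero, Fin.val_one, add_zero] at this
    rw [opL, sq]
    exact this
  have h3 : ∀ i, opL (opL f) i =
      f (i + 2) * (Matrix.of fun a b : Fin 3 => f (i + a + b)).det := fun i => by
    rw [Matrix.det_fin_three]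
    simp only [Matrix.of_apply, Fin.val_zero, Fin.val_one, Fin.val_two, add_zero, opL, add_assoc,
      Nat.reduceAdd]
    ring
  -- This is the Desnanot–Jacobi identity `H_3(i) H_3(i+2) - H_3(i+1)² = H_4(i) H_2(i+2)` inserted
  -- into the formula `h3`.
  have h4 : ∀ i, opL (opL (opL f)) i = opL f (i + 2) *
      (f (i + 2) * f (i + 4) * (Matrix.of fun a b : Fin 4 => f (i + a + b)).det +
        (Matrix.of fun a b : Fin 3 => f (i + 1 + a + b)).det ^ 2) := fun i => by
    rw [opL, h3, h3, h3, det_hankel_four]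
    simp only [Matrix.det_fin_three, Matrix.of_apply, Fin.val_zero, Fin.val_one, Fin.val_two,
      add_zero, opL, add_assoc, Nat.reduceAdd]
    ring
  intro m hm i
  rw [← mem_nonnegCoeff]
  interval_cases m
  · exact h1 i
  · exact h2 i
  · change opL (opL f) i ∈ _
    rw [h3]
    exact mul_mem (h1 _) (h 3 i)
  · change opL (opL (opL f)) i ∈ _
    rw [h4]
    exact mul_mem (h2 _) (add_mem (mul_mem (mul_mem (h1 _) (h1 _)) (h 4 i)) (pow_mem (h 3 _) 2))

/-- The first column of an array generated by a totally positive tridiagonal matrix is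
`3`-`q`-log-convex. -/
theorem IsGeneratedBy.isQLogConvex_three {u g s : ℕ → ℝ[X]} {A : ℕ → ℕ → ℝ[X]}
    (h : IsGeneratedBy A u g s) (hu : ∀ k, u k ∈ nonnegCoeff) (hg : ∀ k, g k ∈ nonnegCoeff)
    (hs : ∀ k, s k ∈ nonnegCoeff) (hD : ∀ p m, continuant u g s p m ∈ nonnegCoeff)
    {f : ℕ → ℝ[X]} (hf : ∀ n, f n = A n 0) : IsQLogConvex 3 f :=
  isQLogConvex_three_of_hankel fun r i => hankel_det_mem_nonnegCoeff hu hg hs hD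
    (fun _ n hn => (h.tridiagMatrix_pow hn 0).trans (hf n).symm) r i

/-- The splitting makes `D (m + 1) - x (p + m) * D m` telescope into a product of values of `y`,
where `D` is the continuant. The conditions are required only from `p` on, so that an exceptional
first row can be skipped. -/
theorem continuant_mem_nonnegCoeff {u g s x y : ℕ → ℝ[X]} {p : ℕ}
    (hx : ∀ k, x k ∈ nonnegCoeff) (hy : ∀ k, y k ∈ nonnegCoeff)
    (hg : ∀ k, p ≤ k → g k = x k + y k) (hus : ∀ k, p ≤ k → u k * s k = x k * y (k + 1))
    (m : ℕ) : continuant u g s p m ∈ nonnegCoeff := by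
  have key : ∀ m, continuant u g s p m ∈ nonnegCoeff ∧
      continuant u g s p (m + 1) - x (p + m) * continuant u g s p m ∈ nonnegCoeff := by
    intro m
    induction m with
    | zero => refine ⟨one_mem _, ?_⟩; simpa [continuant, hg p le_rfl] using hy p
    | succ m ih =>
      have h1 := add_mem ih.2 (mul_mem (hx (p + m)) ih.1)
      rw [sub_add_cancel] at h1
      refine ⟨h1, ?_⟩
      have h2 := mul_mem (hy (p + m + 1)) ih.2
      convert h2 using 1
      rw [continuant, hus _ (by omega), hg (p + m + 1) (by omega), ← add_assoc p m 1]
      ring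
  exact (key m).1

/-! ### Coefficients of powers of `Q = (Y + a) (Y + c)`. -/

section Quadratic

/-- The quadratic `(Y + a) (Y + c)` in `ℝ[X][Y]`. -/
noncomputable def quad (a c : ℝ[X]) : ℝ[X][X] := (X + C a) * (X + C c)

variable (a c : ℝ[X])

theorem quad_eq : quad a c = (X ^ 2 - C (a * c)) + C (a + c) * X + C (2 * (a * c)) := by
  simp only [quad, map_mul, map_add, map_ofNat]
  ring

theorem coeff_mul_quad (p : ℝ[X][X]) (m : ℕ) :
    (p * quad a c).coeff (m + 2) =
      p.coeff m + (a + c) * p.coeff (m + 1) + a * c * p.coeff (m + 2) := by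
  have h : p * quad a c = p * X ^ 2 + C (a + c) * (p * X) + C (a * c) * p := by
    simp only [quad, map_mul, map_add]
    ring
  rw [h, coeff_add, coeff_add, coeff_C_mul, coeff_C_mul, coeff_mul_X_pow, coeff_mul_X]

/-- Since `Y * Q' - Q = Y ^ 2 - a * c`, multiplication by `Y ^ 2 - a * c` acts on `Q ^ n` as the
Euler operator `Y d/dY` does on `Q ^ (n + 1)`, up to a shift. -/
theorem coeff_quad_pow_mul_sub (n m : ℕ) :
    ((n : ℝ[X]) + 1) * (quad a c ^ n * (X ^ 2 - C (a * c))).coeff (m + 1) =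
      ((m : ℝ[X]) - n) * (quad a c ^ (n + 1)).coeff (m + 1) := by
  have h : C ((n : ℝ[X]) + 1) * (quad a c ^ n * (X ^ 2 - C (a * c))) =
      X * derivative (quad a c ^ (n + 1)) - C ((n : ℝ[X]) + 1) * quad a c ^ (n + 1) := by
    rw [derivative_pow_succ]
    simp only [quad, derivative_mul, derivative_X, derivative_C, map_mul, map_add, C_1]
    ring
  have := congrArg (coeff · (m + 1)) h
  simp only [coeff_C_mul, coeff_sub, coeff_X_mul, coeff_derivative] at this
  rw [this]
  ring

theorem coeff_quad_pow_mul_sub_center (n : ℕ) :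
    (quad a c ^ n * (X ^ 2 - C (a * c))).coeff (n + 1) = 0 := by
  have := coeff_quad_pow_mul_sub a c n n
  rw [sub_self, zero_mul] at this
  exact (mul_eq_zero.1 this).resolve_left (by exact_mod_cast n.succ_ne_zero)

theorem coeff_quad_pow_symm (n : ℕ) :
    (quad a c ^ (n + 1)).coeff n = a * c * (quad a c ^ (n + 1)).coeff (n + 2) := by
  have := coeff_quad_pow_mul_sub_center a c (n + 1)
  rw [mul_sub, coeff_sub, coeff_mul_X_pow, coeff_mul_C] at this
  linear_combination this

/-- The central coefficient receives contributions from both neighbours, which agree up to the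
factor `a * c` by symmetry; this is why the first subdiagonal entry is doubled. -/
theorem isGeneratedBy_coeff_quad_pow :
    IsGeneratedBy (fun n k => (quad a c ^ n).coeff (n + k)) (fun _ => 1) (fun _ => a + c)
      (fun k => if k = 0 then 2 * (a * c) else a * c) where
  zero_zero := by simp
  zero_succ k := by simp [coeff_one]
  succ_zero n := by
    have h : quad a c ^ (n + 1) = quad a c ^ n * (X ^ 2 - C (a * c))
        + C (a + c) * (quad a c ^ n * X) + C (2 * (a * c)) * quad a c ^ n := by
      linear_combination quad a c ^ n * quad_eq a c
    simp only [add_zero, if_true]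
    rw [h, coeff_add, coeff_add, coeff_quad_pow_mul_sub_center, coeff_C_mul, coeff_C_mul,
      coeff_mul_X, zero_add]
  succ_succ n k := by
    simp only [Nat.succ_ne_zero, if_false]
    rw [show n + 1 + (k + 1) = n + k + 2 by ring, pow_succ, coeff_mul_quad, one_mul]
    rfl

/-- Power sums obey the recurrence with coefficients `a + c` and `-a * c`. Their value at exponent
`0` is `2` while the empty continuant is `1`, and the doubled entry makes up for this. -/
theorem continuant_typeB (m : ℕ) :
    continuant (fun _ => 1) (fun _ => a + c) (fun k => if k = 0 then 2 * (a * c) else a * c) 0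
      (m + 1) = a ^ (m + 1) + c ^ (m + 1) := by
  induction m using Nat.twoStepInduction with
  | zero => simp [continuant]
  | one => simp [continuant]; ring
  | more m ih1 ih2 =>
    rw [continuant, ih1, ih2]
    simp
    ring

variable {a c}

theorem isQLogConvex_three_of_coeff_quad_pow (ha : a ∈ nonnegCoeff) (hc : c ∈ nonnegCoeff)
    {f : ℕ → ℝ[X]} (hf : ∀ n, f n = (quad a c ^ n).coeff n) : IsQLogConvex 3 f := by
  have hac := mul_mem ha hc
  refine (isGeneratedBy_coeff_quad_pow a c).isQLogConvex_three (fun _ => one_mem _)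
    (fun _ => add_mem ha hc) (fun k => ?_) (fun p m => ?_) hf
  · split_ifs
    · rw [two_mul]; exact add_mem hac hac
    · exact hac
  · rcases Nat.eq_zero_or_pos p with rfl | hp
    · cases m with
      | zero => exact one_mem _
      | succ m => rw [continuant_typeB]; exact add_mem (pow_mem ha _) (pow_mem hc _)
    · refine continuant_mem_nonnegCoeff (x := fun _ => a) (y := fun _ => c) (fun _ => ha)
        (fun _ => hc) (fun _ _ => rfl) (fun k hk => ?_) m
      rw [if_neg (by omega), one_mul]

/-- The weighted ballot numbers generated by the tridiagonal Toeplitz matrix with diagonal `a + c`,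
superdiagonal `1` and subdiagonal `a * c`. -/
noncomputable def ballot (a c : ℝ[X]) (n k : ℕ) : ℝ[X] :=
  (quad a c ^ n * (X ^ 2 - C (a * c))).coeff (n + 2 + k)

theorem ballot_zero_zero : ballot a c 0 0 = 1 := by
  simp [ballot, coeff_X_pow]

theorem ballot_zero_succ (k : ℕ) : ballot a c 0 (k + 1) = 0 := by
  simp [ballot, coeff_X_pow, coeff_C]

/-- The boundary case is the reflection principle: the coefficient one place below column `0` is
zero. -/
theorem ballot_succ_zero (n : ℕ) :
    ballot a c (n + 1) 0 = (a + c) * ballot a c n 0 + a * c * ballot a c n 1 := by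
  have h := coeff_mul_quad a c (quad a c ^ n * (X ^ 2 - C (a * c))) (n + 1)
  rw [coeff_quad_pow_mul_sub_center, zero_add, mul_right_comm, ← pow_succ] at h
  exact h

theorem ballot_succ_succ (n k : ℕ) : ballot a c (n + 1) (k + 1) =
    ballot a c n k + (a + c) * ballot a c n (k + 1) + a * c * ballot a c n (k + 2) := by
  have h := coeff_mul_quad a c (quad a c ^ n * (X ^ 2 - C (a * c))) (n + 2 + k)
  rw [mul_right_comm, ← pow_succ] at h
  rw [ballot, show n + 1 + 2 + (k + 1) = n + 2 + k + 2 by ring, h]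
  rfl

/-- The Catalan–Stieltjes array of the continued fraction with the coefficients
`a, c, a, c, …`. -/
noncomputable def narayanaArray (a c : ℝ[X]) : ℕ → ℕ → ℝ[X]
  | 0, 0 => 1
  | 0, _ + 1 => 0
  | n + 1, 0 => a * ballot a c n 0
  | n + 1, k + 1 => ballot a c n k + a * ballot a c n (k + 1)

theorem isGeneratedBy_narayanaArray :
    IsGeneratedBy (narayanaArray a c) (fun _ => 1) (fun k => if k = 0 then a else a + c)
      (fun _ => a * c) where
  zero_zero := rfl
  zero_succ _ := rfl
  succ_zero n := by
    cases n with
    | zero => simp [narayanaArray, ballot_zero_zero]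
    | succ n => simp [narayanaArray, ballot_succ_zero]; ring
  succ_succ n k := by
    rcases n with _ | n <;> rcases k with _ | k
    · simp [narayanaArray, ballot_zero_zero, ballot_zero_succ]
    · simp [narayanaArray, ballot_zero_succ]
    · simp [narayanaArray, ballot_succ_zero, ballot_succ_succ]; ring
    · simp [narayanaArray, ballot_succ_succ]; ring

theorem isQLogConvex_three_of_natCast_mul_eq (ha : a ∈ nonnegCoeff) (hc : c ∈ nonnegCoeff)
    {f : ℕ → ℝ[X]} (h0 : f 0 = 1)
    (hf : ∀ n : ℕ, ((n : ℝ[X]) + 1) * f (n + 1) = a * (quad a c ^ (n + 1)).coeff (n + 2)) :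
    IsQLogConvex 3 f := by
  refine (isGeneratedBy_narayanaArray (a := a) (c := c)).isQLogConvex_three (fun _ => one_mem _)
    (fun k => ?_) (fun _ => mul_mem ha hc) (fun p m => ?_) (fun n => ?_)
  · split_ifs
    exacts [ha, add_mem ha hc]
  -- The first diagonal entry is `a` alone, hence `y 0 = 0`.
  · refine continuant_mem_nonnegCoeff (x := fun _ => a) (y := fun k => if k = 0 then 0 else c)
      (fun _ => ha) (fun k => ?_) (fun k _ => ?_) (fun k _ => by simp) m
    · split_ifs
      exacts [zero_mem _, hc]
    · split_ifs <;> simp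
  · cases n with
    | zero => exact h0
    | succ n =>
      -- One place above the centre the factor `m - n` equals `1`, so `(n + 1) * ballot a c n 0` is
      -- exactly the coefficient in `hf`.
      have h1 := coeff_quad_pow_mul_sub a c n (n + 1)
      have h2 : ((n : ℝ[X]) + 1) ≠ 0 := by exact_mod_cast n.succ_ne_zero
      refine mul_left_cancel₀ h2 ?_
      rw [hf]
      push_cast at h1
      simp only [narayanaArray, ballot, add_zero]
      linear_combination (-a) * h1

end Quadratic

/-! ### Narayana, Delannoy and Schröder polynomials as such coefficients. -/

theorem coeff_quad_X_one_pow (n m : ℕ) : (quad X 1 ^ n).coeff m =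
    ∑ k ∈ Finset.range (m + 1), (X : ℝ[X]) ^ (n - (m - k)) * (n.choose (m - k) * n.choose k) := by
  rw [quad, mul_pow, coeff_mul, Finset.Nat.sum_antidiagonal_eq_sum_range_succ_mk,
    ← Finset.sum_range_reflect]
  refine Finset.sum_congr rfl fun k hk => ?_
  have hk : k ≤ m := Nat.lt_succ_iff.1 (Finset.mem_range.1 hk)
  rw [coeff_X_add_C_pow, coeff_X_add_C_pow, one_pow, one_mul,
    show m + 1 - 1 - k = m - k by omega, show m - (m - k) = k by omega, mul_assoc]

theorem narayanaPolyB_eq (n : ℕ) : narayanaPolyB n = (quad X 1 ^ n).coeff n := by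
  rw [coeff_quad_X_one_pow, narayanaPolyB]
  refine Finset.sum_congr rfl fun k hk => ?_
  have hk : k ≤ n := Nat.lt_succ_iff.1 (Finset.mem_range.1 hk)
  rw [Nat.sub_sub_self hk, Nat.choose_symm hk]
  simp
  ring

theorem narayanaPolyA_succ (n : ℕ) :
    ((n : ℝ[X]) + 1) * narayanaPolyA (n + 1) = X * (quad X 1 ^ (n + 1)).coeff (n + 2) := by
  rw [coeff_quad_X_one_pow, narayanaPolyA, if_neg n.succ_ne_zero, Finset.mul_sum, Finset.mul_sum]
  have hsub : Finset.Icc 1 (n + 1) ⊆ Finset.range (n + 2 + 1) := fun k => by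
    simp only [Finset.mem_Icc, Finset.mem_range]; omega
  rw [← Finset.sum_subset hsub]
  · refine Finset.sum_congr rfl fun k hk => ?_
    obtain ⟨h1, h2⟩ := Finset.mem_Icc.1 hk
    obtain ⟨k, rfl⟩ : ∃ j, k = j + 1 := ⟨k - 1, by omega⟩
    have hn : (n : ℝ) + 1 ≠ 0 := by positivity
    rw [show n + 2 - (k + 1) = n + 1 - k by omega, show n + 1 - (n + 1 - k) = k by omega,
      Nat.choose_symm (by omega), Nat.add_sub_cancel, pow_succ]
    have h3 : ((n : ℝ[X]) + 1) = C ((n : ℝ) + 1) := by simp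
    rw [h3, ← mul_assoc, ← C_mul]
    have h4 : ((n : ℝ) + 1) * (1 / ((n + 1 : ℕ) : ℝ) * ((n + 1).choose (k + 1) : ℝ) *
        ((n + 1).choose k : ℝ)) = ((n + 1).choose k : ℝ) * ((n + 1).choose (k + 1) : ℝ) := by
      push_cast
      field_simp
    rw [h4]
    simp
    ring
  · intro k hk hk'
    simp only [Finset.mem_Icc, Finset.mem_range] at hk hk'
    rcases Nat.eq_zero_or_pos k with rfl | h
    · simp
    · rw [Nat.choose_eq_zero_of_lt (by omega : n + 1 < k)]
      simp

/-- Here `Q = ((Y + X) + 1) (Y + X)`, and the first factor is expanded in powers of `Y + X`. -/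
theorem coeff_quad_one_add_X_pow (n m : ℕ) : (quad (1 + X) X ^ n).coeff m =
    ∑ k ∈ Finset.range (n + 1),
      (n.choose k * (n + k).choose m : ℝ[X]) * (X : ℝ[X]) ^ (n + k - m) := by
  have h : quad (1 + X) X ^ n = ∑ k ∈ Finset.range (n + 1),
      C (n.choose k : ℝ[X]) * ((X : ℝ[X][X]) + C (X : ℝ[X])) ^ (n + k) := by
    rw [quad, mul_pow, C_add, C_1, add_comm (1 : ℝ[X][X]), ← add_assoc, add_pow, Finset.sum_mul]
    refine Finset.sum_congr rfl fun k _ => ?_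
    rw [C_eq_natCast, one_pow]
    ring
  rw [h, finsetSum_coeff]
  refine Finset.sum_congr rfl fun k _ => ?_
  rw [coeff_C_mul, coeff_X_add_C_pow]
  ring

theorem choose_mul_centralBinom {n k : ℕ} (hk : k ≤ n) :
    (n + k).choose (n - k) * (2 * k).choose k = n.choose k * (n + k).choose k := by
  have h1 : (n + k).choose (n - k) = (n + k).choose (2 * k) :=
    Nat.choose_symm_of_eq_add (by omega)
  rw [h1, Nat.choose_mul (by omega), show n + k - k = n by omega, show 2 * k - k = k by omega,
    mul_comm]

theorem delannoyPoly_eq (n : ℕ) : delannoyPoly n = (quad (1 + X) X ^ n).coeff n := by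
  rw [coeff_quad_one_add_X_pow, delannoyPoly]
  refine Finset.sum_congr rfl fun k hk => ?_
  have hk : k ≤ n := Nat.lt_succ_iff.1 (Finset.mem_range.1 hk)
  rw [Nat.add_sub_cancel_left, ← Nat.cast_mul, ← Nat.cast_mul, choose_mul_centralBinom hk,
    Nat.choose_symm_add (a := n) (b := k), C_eq_natCast]

theorem schroderPoly_succ (n : ℕ) : ((n : ℝ[X]) + 1) * schroderPoly (n + 1) =
    (1 + X) * (quad (1 + X) X ^ (n + 1)).coeff (n + 2) := by
  -- The extra factor `X` completes `a * c = (1 + X) * X`, so symmetry moves the coefficient from `n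
  -- + 2` down to `n`.
  refine mul_left_cancel₀ (X_ne_zero (R := ℝ)) ?_
  have h : X * ((1 + X) * (quad (1 + X) X ^ (n + 1)).coeff (n + 2)) =
      (quad (1 + X) X ^ (n + 1)).coeff n := by
    rw [coeff_quad_pow_symm]; ring
  rw [h, coeff_quad_one_add_X_pow, schroderPoly, Finset.mul_sum, Finset.mul_sum]
  refine Finset.sum_congr rfl fun k hk => ?_
  have hk : k ≤ n + 1 := Nat.lt_succ_iff.1 (Finset.mem_range.1 hk)
  have h1 := choose_mul_centralBinom hk
  have h2 : (n + 1 + k).choose n = (n + 1 + k).choose (k + 1) :=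
    Nat.choose_symm_of_eq_add (by omega)
  have h3 := Nat.choose_succ_right_eq (n + 1 + k) k
  rw [show n + 1 + k - k = n + 1 by omega, ← h2] at h3
  have h1' : (((n + 1 + k).choose (n + 1 - k) : ℝ) * ((2 * k).choose k : ℝ)) =
    ((n + 1).choose k : ℝ) * ((n + 1 + k).choose k : ℝ) := by exact_mod_cast h1
  have h3' : ((n + 1 + k).choose n : ℝ) * ((k : ℝ) + 1) =
    ((n + 1 + k).choose k : ℝ) * ((n : ℝ) + 1) := by exact_mod_cast h3
  have h4 : ((n : ℝ) + 1) * (((n + 1 + k).choose (n + 1 - k) : ℝ) * (1 / ((k : ℝ) + 1)) *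
      ((2 * k).choose k : ℝ)) = ((n + 1).choose k : ℝ) * ((n + 1 + k).choose n : ℝ) := by
    have hk0 : (k : ℝ) + 1 ≠ 0 := by positivity
    field_simp
    linear_combination ((n : ℝ) + 1) * h1' - ((n + 1).choose k : ℝ) * h3'
  have h5 : ((n : ℝ[X]) + 1) = C ((n : ℝ) + 1) := by simp
  rw [show n + 1 + k - n = k + 1 by omega, h5, ← mul_assoc (C ((n : ℝ) + 1)), ← C_mul, h4, C_mul,
    C_eq_natCast, C_eq_natCast]
  ring

/-! ### Bell polynomials, and the conclusions for the families above. -/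

theorem coeff_bellPoly (n k : ℕ) : (bellPoly n).coeff k = Nat.stirlingSecond n k := by
  simp only [bellPoly, finsetSum_coeff, coeff_C_mul, coeff_X_pow, mul_ite, mul_one, mul_zero,
    Finset.sum_ite_eq, Finset.mem_range]
  split_ifs with h
  · rfl
  · rw [Nat.stirlingSecond_eq_zero_of_lt (by omega), Nat.cast_zero]

theorem bellPoly_succ (n : ℕ) :
    bellPoly (n + 1) = X * (bellPoly n + derivative (bellPoly n)) := by
  ext k
  cases k with
  | zero => simp [coeff_bellPoly]
  | succ k =>
    rw [coeff_X_mul, coeff_add, coeff_derivative, coeff_bellPoly, coeff_bellPoly, coeff_bellPoly,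
      Nat.stirlingSecond_succ_succ]
    push_cast
    ring

theorem iterate_derivative_succ_X_mul (p : ℝ[X]) (k : ℕ) :
    derivative^[k + 1] (X * p) =
      X * derivative^[k + 1] p + ((k : ℝ[X]) + 1) * derivative^[k] p := by
  rw [mul_comm, iterate_derivative_mul_X, Nat.add_sub_cancel, nsmul_eq_mul]
  push_cast
  ring

/-- By Leibniz, differentiating `B_{n+1} = X (B_n + B_n')` repeatedly involves only three
consecutive derivatives of `B_n`. -/
theorem isGeneratedBy_iterate_derivative_bellPoly :
    IsGeneratedBy (fun n k => derivative^[k] (bellPoly n)) (fun k => (k : ℝ[X]) + 1)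
      (fun k => X + (k : ℝ[X])) (fun _ => X) where
  zero_zero := by simp [bellPoly]
  zero_succ k := by simp [bellPoly]
  succ_zero n := by simp [bellPoly_succ]; ring
  succ_succ n k := by
    rw [bellPoly_succ, iterate_derivative_succ_X_mul]
    simp only [iterate_map_add, ← Function.iterate_succ_apply]
    push_cast
    ring

theorem natCast_mem_nonnegCoeff (n : ℕ) : (n : ℝ[X]) ∈ nonnegCoeff := natCast_mem _ n

theorem isQLogConvex_bellPoly : IsQLogConvex 3 bellPoly := by
  have hn := natCast_mem_nonnegCoeff
  refine isGeneratedBy_iterate_derivative_bellPoly.isQLogConvex_three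
    (fun k => add_mem (hn k) (one_mem _)) (fun k => add_mem X_mem_nonnegCoeff (hn k))
    (fun _ => X_mem_nonnegCoeff) (fun p m => ?_) (fun _ => rfl)
  refine continuant_mem_nonnegCoeff (x := fun _ => X) (y := fun k => (k : ℝ[X]))
    (fun _ => X_mem_nonnegCoeff) hn (fun _ _ => rfl) (fun k _ => ?_) m
  push_cast
  ring

theorem isQLogConvex_schroderPoly : IsQLogConvex 3 schroderPoly :=
  isQLogConvex_three_of_natCast_mul_eq (add_mem (one_mem _) X_mem_nonnegCoeff) X_mem_nonnegCoeff
    (by simp [schroderPoly]) schroderPoly_succ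

theorem isQLogConvex_delannoyPoly : IsQLogConvex 3 delannoyPoly :=
  isQLogConvex_three_of_coeff_quad_pow (add_mem (one_mem _) X_mem_nonnegCoeff) X_mem_nonnegCoeff
    delannoyPoly_eq

theorem isQLogConvex_narayanaPolyA : IsQLogConvex 3 narayanaPolyA :=
  isQLogConvex_three_of_natCast_mul_eq X_mem_nonnegCoeff (one_mem _) (by simp [narayanaPolyA])
    narayanaPolyA_succ

theorem isQLogConvex_narayanaPolyB : IsQLogConvex 3 narayanaPolyB :=
  isQLogConvex_three_of_coeff_quad_pow X_mem_nonnegCoeff (one_mem _) narayanaPolyB_eq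

/-! ### Descents under insertion of a largest letter, for the Eulerian polynomials. -/

section Insertion

/-- The number of descents among the first `n + 1` letters of a word. -/
def wordDescents (w : ℕ → ℕ) (n : ℕ) : ℕ :=
  ∑ i ∈ Finset.range n, if w (i + 1) < w i then 1 else 0

/-- The word obtained from `w` by inserting the letter `a` at the place `j`. -/
def insertLetter (w : ℕ → ℕ) (j a i : ℕ) : ℕ :=
  if i < j then w i else if i = j then a else w (i - 1)

theorem wordDescents_succ (w : ℕ → ℕ) (n : ℕ) :
    wordDescents w (n + 1) = wordDescents w n + if w (n + 1) < w n then 1 else 0 :=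
  Finset.sum_range_succ _ _

theorem wordDescents_congr {w v : ℕ → ℕ} {n : ℕ} (h : ∀ i ≤ n, w i = v i) :
    wordDescents w n = wordDescents v n := by
  refine Finset.sum_congr rfl fun i hi => ?_
  rw [Finset.mem_range] at hi
  rw [h _ hi, h _ hi.le]

theorem wordDescents_insertLetter_end {w : ℕ → ℕ} {a n : ℕ} (h : w n < a) :
    wordDescents (insertLetter w (n + 1) a) (n + 1) = wordDescents w n := by
  rw [wordDescents_succ, wordDescents_congr (v := w)]
  · simp [insertLetter, h.le]
  · intro i hi
    simp [insertLetter, Nat.lt_succ_iff.2 hi]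

/-- A large letter placed before the end creates a descent to its right and destroys the one it
interrupts, if there is one. -/
theorem wordDescents_insertLetter {w : ℕ → ℕ} {a n j : ℕ} (h : ∀ i ≤ n, w i < a) (hj : j ≤ n) :
    wordDescents (insertLetter w j a) (n + 1) =
      wordDescents w n + if 1 ≤ j ∧ w j < w (j - 1) then 0 else 1 := by
  induction n with
  | zero =>
    obtain rfl : j = 0 := by omega
    have := h 0 le_rfl
    simp only [wordDescents, Finset.sum_range_succ, Finset.sum_range_zero]
    simp [insertLetter, this]
  | succ n ih =>
    rw [wordDescents_succ, wordDescents_succ w]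
    have h2 : insertLetter w j a (n + 1 + 1) = w (n + 1) := by
      unfold insertLetter
      rw [if_neg (by omega), if_neg (by omega)]
      rfl
    rcases Nat.lt_or_ge n j with hlt | hle
    · obtain rfl : j = n + 1 := by omega
      have h3 : insertLetter w (n + 1) a (n + 1) = a := by simp [insertLetter]
      rw [wordDescents_insertLetter_end (h n (by omega)), h2, h3, if_pos (h _ le_rfl)]
      simp only [Nat.add_sub_cancel, Nat.le_add_left, true_and]
      split_ifs <;> rfl
    · rw [ih (fun i hi => h i (by omega)) hle, h2]
      have h4 : insertLetter w j a (n + 1) = w n := by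
        unfold insertLetter
        rw [if_neg (by omega), if_neg (by omega), Nat.add_sub_cancel]
      rw [h4]
      ring

/-- The word of a permutation. -/
def permWord {n : ℕ} (σ : Equiv.Perm (Fin n)) (i : ℕ) : ℕ :=
  if h : i < n then σ ⟨i, h⟩ else 0

theorem descents_eq_wordDescents {m : ℕ} (σ : Equiv.Perm (Fin (m + 1))) :
    descents σ = wordDescents (permWord σ) m := by
  rw [descents, Finset.card_filter, wordDescents, Finset.sum_range]
  refine Finset.sum_congr rfl fun i _ => ?_
  simp only [permWord, Nat.add_lt_add_iff_right, i.2, dite_true, i.2.trans (Nat.lt_succ_self m)]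
  rfl

theorem descents_le {m : ℕ} (σ : Equiv.Perm (Fin (m + 1))) : descents σ ≤ m :=
  (Finset.card_le_univ _).trans (Fintype.card_fin m).le

/-- The permutation obtained from `σ` by inserting a new largest letter at the place `j`. -/
def insertMax {n : ℕ} (j : Fin (n + 1)) (σ : Equiv.Perm (Fin n)) : Equiv.Perm (Fin (n + 1)) :=
  ((finSuccEquiv' j).trans σ.optionCongr).trans (finSuccEquiv' (Fin.last n)).symm

theorem insertMax_self {n : ℕ} (j : Fin (n + 1)) (σ : Equiv.Perm (Fin n)) :
    insertMax j σ j = Fin.last n := by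
  simp [insertMax]

theorem insertMax_succAbove {n : ℕ} (j : Fin (n + 1)) (σ : Equiv.Perm (Fin n)) (i : Fin n) :
    insertMax j σ (j.succAbove i) = (σ i).castSucc := by
  simp [insertMax]

theorem insertMax_bijective (n : ℕ) : Function.Bijective
    fun p : Fin (n + 1) × Equiv.Perm (Fin n) => insertMax p.1 p.2 := by
  rw [Fintype.bijective_iff_injective_and_card]
  constructor
  · rintro ⟨j, σ⟩ ⟨k, τ⟩ h
    have h : insertMax j σ = insertMax k τ := h
    obtain rfl : j = k := by
      refine (insertMax j σ).injective ?_
      rw [insertMax_self, h, insertMax_self]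
    have : σ = τ := by
      ext1 i
      refine Fin.castSucc_injective n ?_
      rw [← insertMax_succAbove j, h, insertMax_succAbove]
    rw [this]
  · simp [Fintype.card_perm, Nat.factorial_succ]

theorem permWord_insertMax {n : ℕ} (j : Fin (n + 1)) (σ : Equiv.Perm (Fin n)) {i : ℕ}
    (hi : i ≤ n) : permWord (insertMax j σ) i = insertLetter (permWord σ) j n i := by
  have hj := j.2
  have hi' : i < n + 1 := by omega
  rw [permWord, dif_pos hi', insertLetter]
  rcases lt_trichotomy i j with h | h | h
  · have e : (⟨i, hi'⟩ : Fin (n + 1)) = j.succAbove ⟨i, by omega⟩ := by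
      rw [Fin.succAbove_of_castSucc_lt _ _ (by simpa [Fin.lt_def] using h)]
      rfl
    rw [e, insertMax_succAbove, if_pos h, permWord, dif_pos (by omega)]
    rfl
  · have e : (⟨i, hi'⟩ : Fin (n + 1)) = j := Fin.ext h
    rw [e, insertMax_self, if_neg (by omega), if_pos h]
    rfl
  · have e : (⟨i, hi'⟩ : Fin (n + 1)) = j.succAbove ⟨i - 1, by omega⟩ := by
      rw [Fin.succAbove_of_le_castSucc _ _ (by simp only [Fin.le_def, Fin.val_castSucc]; omega)]
      ext
      simp only [Fin.val_succ]
      omega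
    rw [e, insertMax_succAbove, if_neg (by omega), if_neg (by omega), permWord,
      dif_pos (by omega)]
    rfl

theorem descents_insertMax {m : ℕ} (j : Fin (m + 2)) (σ : Equiv.Perm (Fin (m + 1))) :
    descents (insertMax j σ) = descents σ +
      if (j : ℕ) = m + 1 ∨ 1 ≤ (j : ℕ) ∧ permWord σ j < permWord σ (j - 1) then 0 else 1 := by
  have hj := j.2
  have hlt : ∀ i ≤ m, permWord σ i < m + 1 := fun i hi => by
    rw [permWord, dif_pos (by omega)]
    exact (σ _).2
  rw [descents_eq_wordDescents, descents_eq_wordDescents,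
    wordDescents_congr fun i hi => permWord_insertMax j σ hi]
  by_cases h : (j : ℕ) = m + 1
  · rw [h, wordDescents_insertLetter_end (hlt m le_rfl), if_pos (Or.inl rfl), add_zero]
  · rw [wordDescents_insertLetter hlt (by omega)]
    simp only [h, false_or]

theorem sum_descents_insertMax {R : Type*} [CommRing R] {m : ℕ} (σ : Equiv.Perm (Fin (m + 1)))
    (F : ℕ → R) : ∑ j, F (descents (insertMax j σ)) =
      (descents σ + 1 : R) * F (descents σ) + (m + 1 - descents σ : R) * F (descents σ + 1) := by
  set w := permWord σ with hw
  -- `c` marks the places that keep the number of descents: the end, and the interior of each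
  -- descent.
  set c : ℕ → R := fun j => if j = m + 1 ∨ 1 ≤ j ∧ w j < w (j - 1) then 1 else 0 with hc
  have h1 : ∑ j ∈ Finset.range (m + 2), c j = descents σ + 1 := by
    rw [Finset.sum_range_succ, Finset.sum_range_succ', descents_eq_wordDescents, wordDescents,
      Nat.cast_sum]
    have h0 : c 0 = 0 := by simp [hc]
    have hm : c (m + 1) = 1 := by simp [hc]
    rw [h0, hm, add_zero]
    congr 1
    refine Finset.sum_congr rfl fun i hi => ?_
    have : i ≠ m := (Finset.mem_range.1 hi).ne
    simp [hc, this, hw]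
  have h2 : ∀ j : Fin (m + 2), F (descents (insertMax j σ)) =
      F (descents σ + 1) + c j * (F (descents σ) - F (descents σ + 1)) := by
    intro j
    rw [descents_insertMax]
    simp only [hc, ← hw]
    split_ifs <;> simp
  rw [Finset.sum_congr rfl fun j _ => h2 j, Finset.sum_add_distrib, ← Finset.sum_mul,
    ← Finset.sum_range (fun j => c j), h1]
  simp
  ring

end Insertion

/-- The homogeneous Eulerian polynomial in `Y + X` and `Y + 1`. -/
noncomputable def eulerianShift : ℕ → ℝ[X][X]
  | 0 => 1
  | m + 1 => ∑ σ : Equiv.Perm (Fin (m + 1)),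
      ((X : ℝ[X][X]) + C X) ^ (descents σ + 1) * (X + 1) ^ (m - descents σ)

/-- Differentiating `(Y + X) ^ (d + 1) * (Y + 1) ^ (m + 1 - d)` gives the weights `d + 1` and `m + 1
- d`, which are the numbers of insertion places that keep or raise the descent number `d`. -/
theorem eulerianShift_succ (n : ℕ) :
    eulerianShift (n + 1) = (X + C X) * derivative ((X + 1) * eulerianShift n) := by
  cases n with
  | zero =>
    have h : ∀ σ : Equiv.Perm (Fin 1), descents σ = 0 := fun σ => Nat.le_zero.1 (descents_le σ)
    simp [eulerianShift, h]
  | succ m =>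
    rw [eulerianShift, ← (insertMax_bijective (m + 1)).sum_comp, Fintype.sum_prod_type_right,
      eulerianShift, Finset.mul_sum, derivative_sum, Finset.mul_sum]
    refine Finset.sum_congr rfl fun σ _ => ?_
    rw [sum_descents_insertMax σ
      fun d => ((X : ℝ[X][X]) + C X) ^ (d + 1) * (X + 1) ^ (m + 1 - d)]
    obtain ⟨e, he⟩ := Nat.exists_eq_add_of_le (descents_le σ)
    rw [show m + 1 - descents σ = e + 1 by omega, show m + 1 - (descents σ + 1) = e by omega,
      show m - descents σ = e by omega]
    have h : ((m : ℝ[X][X]) + 1 - descents σ) = e + 1 := by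
      have he' : (m : ℝ[X][X]) = descents σ + e := by exact_mod_cast he
      rw [he']
      ring
    rw [h, mul_left_comm (X + 1 : ℝ[X][X]), ← pow_succ', derivative_mul,
      derivative_pow_succ, derivative_pow_succ]
    simp
    ring

theorem eulerianPoly_eq (n : ℕ) : eulerianPoly n = (eulerianShift n).coeff 0 := by
  cases n with
  | zero => simp [eulerianPoly, eulerianShift, eulerianNumber]
  | succ m =>
    have h : (eulerianShift (m + 1)).coeff 0 =
        ∑ σ : Equiv.Perm (Fin (m + 1)), (X : ℝ[X]) ^ (descents σ + 1) := by
      simp [eulerianShift, coeff_zero_eq_eval_zero, eval_finsetSum]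
    rw [h, eulerianPoly, ← Finset.sum_fiberwise_of_maps_to (t := Finset.range (m + 1 + 1))
      (g := fun σ => descents σ + 1)]
    · refine Finset.sum_congr rfl fun k _ => ?_
      rw [Finset.sum_congr rfl fun σ hσ => by rw [(Finset.mem_filter.1 hσ).2]]
      simp [eulerianNumber]
    · intro σ _
      have := descents_le σ
      simp only [Finset.mem_range]
      omega

/-- The operator in `eulerianShift_succ` shifts the degree in `Y` by at most one either way, so it
is tridiagonal on coefficients; `Y = 0` returns the Eulerian polynomial. -/
theorem isGeneratedBy_coeff_eulerianShift :
    IsGeneratedBy (fun n k => (eulerianShift n).coeff k) (fun k => (k : ℝ[X]) + 1)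
      (fun k => ((k : ℝ[X]) + 1) * X + (k : ℝ[X])) (fun k => ((k : ℝ[X]) + 1) * X) where
  zero_zero := by simp [eulerianShift]
  zero_succ k := by simp [eulerianShift, coeff_one]
  succ_zero n := by
    rw [eulerianShift_succ]
    simp only [add_mul, one_mul, derivative_add, coeff_add, coeff_C_mul, coeff_X_mul_zero,
      coeff_derivative, coeff_X_mul]
    push_cast
    ring
  succ_succ n k := by
    rw [eulerianShift_succ]
    simp only [add_mul, one_mul, derivative_add, coeff_add, coeff_C_mul, coeff_derivative,
      coeff_X_mul]
    push_cast
    ring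

theorem isQLogConvex_eulerianPoly : IsQLogConvex 3 eulerianPoly := by
  have hn := natCast_mem_nonnegCoeff
  have hX : ∀ k : ℕ, ((k : ℝ[X]) + 1) * X ∈ nonnegCoeff := fun k =>
    mul_mem (add_mem (hn k) (one_mem _)) X_mem_nonnegCoeff
  refine isGeneratedBy_coeff_eulerianShift.isQLogConvex_three
    (fun k => add_mem (hn k) (one_mem _)) (fun k => add_mem (hX k) (hn k)) hX (fun p m => ?_)
    eulerianPoly_eq
  refine continuant_mem_nonnegCoeff (x := fun k => ((k : ℝ[X]) + 1) * X)
    (y := fun k => (k : ℝ[X])) hX hn (fun _ _ => rfl) (fun k _ => ?_) m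
  push_cast
  ring

end QLogConvex

theorem proposition4p3 :
    QLogConvex.IsQLogConvex 3 QLogConvex.bellPoly ∧
    QLogConvex.IsQLogConvex 3 QLogConvex.eulerianPoly ∧
    QLogConvex.IsQLogConvex 3 QLogConvex.schroderPoly ∧
    QLogConvex.IsQLogConvex 3 QLogConvex.delannoyPoly ∧
    QLogConvex.IsQLogConvex 3 QLogConvex.narayanaPolyA ∧
    QLogConvex.IsQLogConvex 3 QLogConvex.narayanaPolyB :=
  ⟨QLogConvex.isQLogConvex_bellPoly, QLogConvex.isQLogConvex_eulerianPoly,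
    QLogConvex.isQLogConvex_schroderPoly, QLogConvex.isQLogConvex_delannoyPoly,
    QLogConvex.isQLogConvex_narayanaPolyA, QLogConvex.isQLogConvex_narayanaPolyB⟩
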